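/- Let $n\ge 1$. A cube $Q\subset\mathbb R^n$ is a closed cube with positive side length and sides parallel to the coordinate axes, and $|Q|$ is its Lebesgue measure. For $\alpha\in[0,1]$ and a locally integrable $f:\mathbb R^n\to\mathbb C$ put $$f_Q:=\frac1{|Q|}\int_Q f(y)\,dy,\qquad \mathcal O_\alpha(f;Q):=\frac{1}{|Q|^{1+\alpha/n}}\int_Q|f(x)-f_Q|\,dx .$$ Let $\mathrm{BMO}_\alpha(\mathbb R^n)$ be the space of all $f\in L^1_{loc}(\mathbb R^n)$ with $\|f\|_{\mathrm{BMO}_\alpha}:=\sup_Q\mathcal O_\alpha(f;Q)<\infty$, where functions that agree almost everywhere are identified, and let $\widetilde{\mathrm{CMO}}_\alpha(\mathbb R^n)$ be the closure of $C_c^\infty(\mathbb R^n)$ (complex-valued smooth functions with compact support) in $\mathrm{BMO}_\alpha(\mathbb R^n)$ with respect to the seminorm $\|\cdot\|_{\mathrm{BMO}_\alpha}$. Let $\mathrm{CMO}_\alpha(\mathbb R^n)$ be the space of all $f\in\mathrm{BMO}_\alpha(\mathbb R^n)$ such that 1. $\lim_{r\to0^+}\ \sup_{|Q|=r}\mathcal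 O_\alpha(f;Q)=0$, 2. $\lim_{r\to\infty}\ \sup_{|Q|=r}\mathcal O_\alpha(f;Q)=0$, 3. $\lim_{d\to\infty}\ \sup_{Q\cap[-d,d]^n=\emptyset}\mathcal O_\alpha(f;Q)=0$. **Theorem.** For every $\alpha\in[0,1)$ (the case $\alpha=0$ being Uchiyama's theorem), $$\widetilde{\mathrm{CMO}}_\alpha(\mathbb R^n)=\mathrm{CMO}_\alpha(\mathbb R^n).$$ For $\alpha=1$, $\mathrm{CMO}_1(\mathbb R^n)\subsetneqq\widetilde{\mathrm{CMO}}_1(\mathbb R^n)$; in fact, $\mathrm{CMO}_1(\mathbb R^n)$ consists exactly of the (almost everywhere) constant functions $f\equiv c$, $c\in\mathbb C$. -/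

import Mathlib

open MeasureTheory Filter Topology
open scoped ENNReal

namespace FracOsc

/-- A closed nondegenerate cube in `ℝⁿ` with sides parallel to the coordinate axes, given by its
lower corner and its side length. -/
structure Cube (n : ℕ) where
  corner : Fin n → ℝ
  side : ℝ
  side_pos : 0 < side

/-- The set of points of a cube. -/
def Cube.toSet {n : ℕ} (Q : Cube n) : Set (Fin n → ℝ) :=
  Set.Icc Q.corner (fun i => Q.corner i + Q.side)

/-- The mean value `f_Q` of `f` over the cube `Q`. -/
noncomputable def mean {n : ℕ} (f : (Fin n → ℝ) → ℂ) (Q : Cube n) : ℂ :=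
  ⨍ y in Q.toSet, f y

/-- The fractional mean oscillation `|Q| ^ (-(1 + α / n)) * ∫_Q |f - f_Q|`, as an element of
`[0, ∞]` (it is finite for locally integrable `f`). -/
noncomputable def osc {n : ℕ} (α : ℝ) (f : (Fin n → ℝ) → ℂ) (Q : Cube n) : ℝ≥0∞ :=
  (∫⁻ x in Q.toSet, ‖f x - mean f Q‖ₑ) / volume Q.toSet ^ (1 + α / (n : ℝ))

/-- The seminorm of `BMO_α`, with values in `[0, ∞]`. -/
noncomputable def bmoNorm {n : ℕ} (α : ℝ) (f : (Fin n → ℝ) → ℂ) : ℝ≥0∞ :=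
  ⨆ Q : Cube n, osc α f Q

/-- The space `BMO_α(ℝⁿ)` of locally integrable functions of bounded fractional mean oscillation.
Elements are functions; membership depends only on the almost everywhere class. -/
def BMO (n : ℕ) (α : ℝ) : Set ((Fin n → ℝ) → ℂ) :=
  {f | LocallyIntegrable f volume ∧ bmoNorm α f < ⊤}

/-- The space `C_c^∞(ℝⁿ)` of smooth compactly supported complex-valued functions. -/
def testFunctions (n : ℕ) : Set ((Fin n → ℝ) → ℂ) :=
  {g | ContDiff ℝ ((⊤ : ℕ∞) : WithTop ℕ∞) g ∧ HasCompactSupport g}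

/-- The closure of `C_c^∞(ℝⁿ)` in `BMO_α(ℝⁿ)`, for the topology of the seminorm of `BMO_α`. -/
def closureTest (n : ℕ) (α : ℝ) : Set ((Fin n → ℝ) → ℂ) :=
  {f | f ∈ BMO n α ∧ ∀ ε : ℝ≥0∞, 0 < ε → ∃ g ∈ testFunctions n, bmoNorm α (f - g) < ε}

/-- The space `CMO_α(ℝⁿ)`: the functions in `BMO_α(ℝⁿ)` whose fractional mean oscillation vanishes
uniformly over small cubes, over large cubes, and over cubes far from the origin. -/
def CMO (n : ℕ) (α : ℝ) : Set ((Fin n → ℝ) → ℂ) :=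
  {f | f ∈ BMO n α ∧
    Tendsto (fun r : ℝ => ⨆ (Q : Cube n) (_ : volume Q.toSet = ENNReal.ofReal r), osc α f Q)
      (𝓝[>] 0) (𝓝 0) ∧
    Tendsto (fun r : ℝ => ⨆ (Q : Cube n) (_ : volume Q.toSet = ENNReal.ofReal r), osc α f Q)
      atTop (𝓝 0) ∧
    Tendsto (fun d : ℝ => ⨆ (Q : Cube n)
        (_ : Q.toSet ∩ Set.Icc (fun _ => -d) (fun _ => d) = ∅), osc α f Q)
      atTop (𝓝 0)}

end FracOsc

/-! Mollify at scale `t`. On a cube of side `4 * t` where `f` has normalised oscillation at most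
`η`, the gradient of `conv k f` at the centre is `O(η t^(α-1))`, and `f - conv k f` has integral
`O(η t^(n+α))` on suitable subcubes of side `t`. If this holds for every cube of that one size, then
`conv k f` has oscillation `O(η)` on cubes of side at most `t`, and `f - conv k f` has oscillation
`O(η)` on cubes of side at least `t` (`exists_mollifier_osc_le`).

For `f` in `CMO_α` and `t` small, `f` itself is good on small cubes, so `f - conv k f` is small in
`BMO_α`. For `t'` large, `f` is good on large cubes, so `conv k' f` is small (`exists_conv_approx`).
What remains, `conv k f - conv k' f`, is smooth and, by the third condition, vanishes at infinity
with its gradient (`conv_sub_conv_vanish`). A slow cutoff therefore approximates it by test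
functions (`exists_testFunction_approx`).

Conversely, a test function satisfies the three conditions when `α < 1`, and these survive limits in
the seminorm. At `α = 1` a gradient does not make the oscillation decay on small cubes. There the
bound on `conv k f` holds on cubes of every size, so letting `t → 0` forces every oscillation of `f
∈ CMO_1` to be zero. -/

namespace FracOsc

/-! ### Cubes and elementary estimates for the mean oscillation -/

section Cubes

variable {n : ℕ}

/-- The cube with centre `x` and side `2 * r`. -/
def Cube.ball (x : Fin n → ℝ) (r : ℝ) (hr : 0 < r) : Cube n :=
  ⟨fun i => x i - r, 2 * r, by positivity⟩

theorem Cube.mem_toSet {Q : Cube n} {x : Fin n → ℝ} :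
    x ∈ Q.toSet ↔ ∀ i, Q.corner i ≤ x i ∧ x i ≤ Q.corner i + Q.side := by
  simp [Cube.toSet, Set.mem_Icc, Pi.le_def, forall_and]

theorem Cube.toSet_ball (x : Fin n → ℝ) (r : ℝ) (hr : 0 < r) :
    (Cube.ball x r hr).toSet = Metric.closedBall x r := by
  ext y
  rw [Cube.mem_toSet, Metric.mem_closedBall, dist_pi_le_iff hr.le]
  refine forall_congr' fun i => ?_
  simp only [Cube.ball, Real.dist_eq, abs_le]
  constructor <;> rintro ⟨h₁, h₂⟩ <;> constructor <;> linarith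

theorem Cube.isCompact_toSet (Q : Cube n) : IsCompact Q.toSet := isCompact_Icc

theorem Cube.measurableSet_toSet (Q : Cube n) : MeasurableSet Q.toSet := measurableSet_Icc

theorem Cube.volume_toSet (Q : Cube n) : volume Q.toSet = ENNReal.ofReal (Q.side ^ n) := by
  simp [Cube.toSet, Real.volume_Icc_pi, ENNReal.ofReal_pow Q.side_pos.le]

theorem Cube.volume_real_toSet (Q : Cube n) : volume.real Q.toSet = Q.side ^ n := by
  rw [measureReal_def, Q.volume_toSet, ENNReal.toReal_ofReal (pow_nonneg Q.side_pos.le n)]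

theorem Cube.volume_toSet_ne_top (Q : Cube n) : volume Q.toSet ≠ ∞ := by
  rw [Q.volume_toSet]; exact ENNReal.ofReal_ne_top

theorem Cube.volume_toSet_ne_zero (Q : Cube n) : volume Q.toSet ≠ 0 := by
  rw [Q.volume_toSet, Ne, ENNReal.ofReal_eq_zero, not_le]
  exact pow_pos Q.side_pos n

theorem Cube.corner_mem (Q : Cube n) : Q.corner ∈ Q.toSet :=
  Cube.mem_toSet.2 fun i => ⟨le_rfl, by linarith [Q.side_pos]⟩

theorem Cube.norm_sub_le {Q : Cube n} {x y : Fin n → ℝ} (hx : x ∈ Q.toSet) (hy : y ∈ Q.toSet) :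
    ‖x - y‖ ≤ Q.side := by
  rw [Cube.mem_toSet] at hx hy
  refine (pi_norm_le_iff_of_nonneg Q.side_pos.le).2 fun i => ?_
  rw [Pi.sub_apply, Real.norm_eq_abs, abs_le]
  constructor <;> linarith [(hx i).1, (hx i).2, (hy i).1, (hy i).2]

/-- The unnormalised mean oscillation `∫_Q |f - f_Q|`. -/
noncomputable def dev (f : (Fin n → ℝ) → ℂ) (Q : Cube n) : ℝ :=
  ∫ x in Q.toSet, ‖f x - mean f Q‖

theorem dev_nonneg (f : (Fin n → ℝ) → ℂ) (Q : Cube n) : 0 ≤ dev f Q :=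
  integral_nonneg fun _ => norm_nonneg _

variable {f g : (Fin n → ℝ) → ℂ}

theorem integrableOn_cube (hf : LocallyIntegrable f volume) (Q : Cube n) :
    IntegrableOn f Q.toSet := hf.integrableOn_isCompact Q.isCompact_toSet

theorem integrableOn_sub_const (hf : LocallyIntegrable f volume) (Q : Cube n) (c : ℂ) :
    IntegrableOn (fun x => f x - c) Q.toSet :=
  (integrableOn_cube hf Q).sub (integrableOn_const Q.volume_toSet_ne_top)

theorem osc_eq (hn : 0 < n) (α : ℝ) (hf : LocallyIntegrable f volume) (Q : Cube n) :
    osc α f Q = ENNReal.ofReal (dev f Q / Q.side ^ (n + α : ℝ)) := by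
  have hs := Q.side_pos
  have hn' : (n : ℝ) ≠ 0 := by positivity
  rw [osc, ← ofReal_integral_norm_eq_lintegral_enorm (integrableOn_sub_const hf Q _),
    Q.volume_toSet, ENNReal.ofReal_rpow_of_pos (pow_pos hs n),
    ← ENNReal.ofReal_div_of_pos (Real.rpow_pos_of_pos (pow_pos hs n) _), dev,
    ← Real.rpow_natCast_mul hs.le]
  congr 3
  field_simp

theorem osc_le_iff (hn : 0 < n) {α : ℝ} (hf : LocallyIntegrable f volume) (Q : Cube n) {a : ℝ}
    (ha : 0 ≤ a) : osc α f Q ≤ ENNReal.ofReal a ↔ dev f Q ≤ a * Q.side ^ (n + α : ℝ) := by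
  rw [osc_eq hn α hf, ENNReal.ofReal_le_ofReal_iff ha,
    div_le_iff₀ (Real.rpow_pos_of_pos Q.side_pos _)]

/-- Replacing an arbitrary constant by the mean costs at most a factor 2, because `|Q| ‖c - f_Q‖` is
itself bounded by `∫_Q ‖f - c‖`. -/
theorem dev_le (hf : LocallyIntegrable f volume) (Q : Cube n) (c : ℂ) :
    dev f Q ≤ 2 * ∫ x in Q.toSet, ‖f x - c‖ := by
  have hi := integrableOn_sub_const hf Q c
  have h1 : volume.real Q.toSet * ‖c - mean f Q‖ ≤ ∫ x in Q.toSet, ‖f x - c‖ := by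
    have h2 : volume.real Q.toSet • (mean f Q - c) = ∫ x in Q.toSet, (f x - c) := by
      rw [integral_sub (integrableOn_cube hf Q) (integrableOn_const Q.volume_toSet_ne_top),
        setIntegral_const, smul_sub, mean, measure_smul_setAverage _ Q.volume_toSet_ne_top]
    calc volume.real Q.toSet * ‖c - mean f Q‖ = ‖volume.real Q.toSet • (mean f Q - c)‖ := by
          rw [norm_smul, norm_sub_rev, Real.norm_of_nonneg measureReal_nonneg]
      _ ≤ _ := by rw [h2]; exact norm_integral_le_integral_norm _
  calc dev f Q ≤ ∫ x in Q.toSet, (‖f x - c‖ + ‖c - mean f Q‖) := by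
        refine integral_mono (integrableOn_sub_const hf Q _).norm
          (hi.norm.add (integrableOn_const Q.volume_toSet_ne_top)) fun x => ?_
        exact norm_sub_le_norm_sub_add_norm_sub _ _ _
    _ = (∫ x in Q.toSet, ‖f x - c‖) + volume.real Q.toSet * ‖c - mean f Q‖ := by
        rw [integral_add hi.norm (integrableOn_const Q.volume_toSet_ne_top), setIntegral_const,
          smul_eq_mul]
    _ ≤ _ := by linarith

theorem dev_le_of_norm_sub_le (hf : LocallyIntegrable f volume) (Q : Cube n) (c : ℂ) {a : ℝ}
    (h : ∀ x ∈ Q.toSet, ‖f x - c‖ ≤ a) : dev f Q ≤ 2 * (a * Q.side ^ n) := by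
  refine (dev_le hf Q c).trans (mul_le_mul_of_nonneg_left ?_ zero_le_two)
  calc ∫ x in Q.toSet, ‖f x - c‖ ≤ ∫ _ in Q.toSet, a :=
        setIntegral_mono_on (integrableOn_sub_const hf Q c).norm
          (integrableOn_const Q.volume_toSet_ne_top) Q.measurableSet_toSet h
    _ = a * Q.side ^ n := by rw [setIntegral_const, Q.volume_real_toSet, smul_eq_mul, mul_comm]

theorem dev_add_le (hf : LocallyIntegrable f volume) (hg : LocallyIntegrable g volume)
    (Q : Cube n) : dev (f + g) Q ≤ dev f Q + dev g Q := by
  have hm : mean (f + g) Q = mean f Q + mean g Q := by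
    simp only [mean, setAverage_eq, Pi.add_apply]
    rw [integral_add (integrableOn_cube hf Q) (integrableOn_cube hg Q), smul_add]
  rw [dev, dev, dev, ← integral_add (integrableOn_sub_const hf Q _).norm
    (integrableOn_sub_const hg Q _).norm, hm]
  refine integral_mono ?_ ((integrableOn_sub_const hf Q _).norm.add
    (integrableOn_sub_const hg Q _).norm) fun x => ?_
  · exact (integrableOn_sub_const (hf.add hg) Q _).norm
  · simp only [Pi.add_apply]
    rw [add_sub_add_comm]
    exact norm_add_le _ _

theorem osc_add_le (hn : 0 < n) (α : ℝ) (hf : LocallyIntegrable f volume)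
    (hg : LocallyIntegrable g volume) (Q : Cube n) :
    osc α (f + g) Q ≤ osc α f Q + osc α g Q := by
  have := Real.rpow_pos_of_pos Q.side_pos (n + α)
  rw [osc_eq hn α hf, osc_eq hn α hg, osc_eq hn α (hf.add hg), ← ENNReal.ofReal_add
    (div_nonneg (dev_nonneg f Q) this.le) (div_nonneg (dev_nonneg g Q) this.le), ← add_div]
  exact ENNReal.ofReal_le_ofReal (div_le_div_of_nonneg_right (dev_add_le hf hg Q) this.le)

theorem bmoNorm_add_le (hn : 0 < n) (α : ℝ) (hf : LocallyIntegrable f volume)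
    (hg : LocallyIntegrable g volume) :
    bmoNorm α (f + g) ≤ bmoNorm α f + bmoNorm α g :=
  iSup_le fun Q => (osc_add_le hn α hf hg Q).trans
    (add_le_add (le_iSup (osc α f) Q) (le_iSup (osc α g) Q))

/-- A bounded Lipschitz function with small constants is small in `BMO_α`. -/
theorem bmoNorm_le_of_lipschitz (hn : 0 < n) {α : ℝ} (h0 : 0 ≤ α) (h1 : α ≤ 1)
    (hf : Continuous f) {a : ℝ} (ha : 0 ≤ a) (hb : ∀ x, ‖f x‖ ≤ a)
    (hL : ∀ x y, ‖f x - f y‖ ≤ a * ‖x - y‖) : bmoNorm α f ≤ ENNReal.ofReal (2 * a) := by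
  refine iSup_le fun Q => (osc_le_iff hn hf.locallyIntegrable Q (by positivity)).2 ?_
  have hs := Q.side_pos
  rw [Real.rpow_add hs, Real.rpow_natCast]
  have hp := pow_pos hs n
  -- Large cubes use the sup bound and `1 ≤ side ^ α` (from `0 ≤ α`); small cubes use the Lipschitz
  -- bound and `side ≤ side ^ α` (from `α ≤ 1`).
  rcases le_total 1 Q.side with h | h
  · refine (dev_le_of_norm_sub_le hf.locallyIntegrable Q 0 (a := a)
      fun x _ => by simpa using hb x).trans ?_
    have : 1 ≤ Q.side ^ α := Real.one_le_rpow h h0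
    have : a * Q.side ^ n * 1 ≤ a * Q.side ^ n * Q.side ^ α := by gcongr
    linarith
  · refine (dev_le_of_norm_sub_le hf.locallyIntegrable Q (f Q.corner) (a := a * Q.side)
      fun x hx => (hL _ _).trans
        (mul_le_mul_of_nonneg_left (Cube.norm_sub_le hx Q.corner_mem) ha)).trans ?_
    have : Q.side ≤ Q.side ^ α := by
      simpa using Real.rpow_le_rpow_of_exponent_ge hs h h1
    have : a * Q.side ^ n * Q.side ≤ a * Q.side ^ n * Q.side ^ α := by gcongr
    linarith

end Cubes

/-- The three vanishing conditions, in terms of side lengths. -/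
theorem mem_CMO_iff {n : ℕ} (hn : 0 < n) {α : ℝ} {f : (Fin n → ℝ) → ℂ} :
    f ∈ CMO n α ↔ f ∈ BMO n α ∧ ∀ ε : ℝ≥0∞, 0 < ε →
      (∃ δ : ℝ, 0 < δ ∧ ∀ Q : Cube n, Q.side < δ → osc α f Q ≤ ε) ∧
      (∃ R : ℝ, 0 < R ∧ ∀ Q : Cube n, R ≤ Q.side → osc α f Q ≤ ε) ∧
      ∃ d : ℝ, ∀ Q : Cube n, Q.toSet ∩ Set.Icc (fun _ => -d) (fun _ => d) = ∅ →
        osc α f Q ≤ ε := by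
  have hvol : ∀ (Q : Cube n) (r : ℝ), 0 < r →
      (volume Q.toSet = ENNReal.ofReal r ↔ Q.side ^ n = r) := fun Q r hr => by
    rw [Q.volume_toSet, ENNReal.ofReal_eq_ofReal_iff (pow_nonneg Q.side_pos.le n) hr.le]
  simp only [CMO, Set.mem_ofPred_eq, ENNReal.tendsto_nhds_zero, iSup_le_iff]
  refine and_congr_right fun _ => ⟨fun ⟨h1, h2, h3⟩ ε hε => ⟨?_, ?_, ?_⟩, fun h => ⟨?_, ?_, ?_⟩⟩
  · obtain ⟨δ, hδ, h⟩ := mem_nhdsGT_iff_exists_Ioo_subset.1 (h1 ε hε)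
    have hδ : 0 < δ := hδ
    -- The cap at 1 gives `side ^ n ≤ side`, which turns a bound on the side into one on the volume.
    refine ⟨min 1 δ, lt_min one_pos hδ, fun Q hQ => ?_⟩
    have hs := Q.side_pos
    refine h ⟨pow_pos hs n, ?_⟩ Q Q.volume_toSet
    calc Q.side ^ n ≤ Q.side := pow_le_of_le_one hs.le (hQ.le.trans (min_le_left _ _)) hn.ne'
      _ < δ := hQ.trans_le (min_le_right _ _)
  · obtain ⟨R, h⟩ := eventually_atTop.1 (h2 ε hε)
    refine ⟨max 1 R, lt_max_of_lt_left one_pos, fun Q hQ => h (Q.side ^ n) ?_ Q Q.volume_toSet⟩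
    calc R ≤ Q.side := (le_max_right _ _).trans hQ
      _ ≤ Q.side ^ n := le_self_pow₀ ((le_max_left _ _).trans hQ) hn.ne'
  · obtain ⟨d, h⟩ := eventually_atTop.1 (h3 ε hε)
    exact ⟨d, h d le_rfl⟩
  · intro ε hε
    obtain ⟨δ, hδ, h⟩ := (h ε hε).1
    filter_upwards [Ioo_mem_nhdsGT (pow_pos hδ n)] with r hr Q hQ
    rw [hvol Q r hr.1] at hQ
    refine h Q (lt_of_pow_lt_pow_left₀ n hδ.le ?_)
    rw [hQ]; exact hr.2
  · intro ε hε
    obtain ⟨R, hR, h⟩ := (h ε hε).2.1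
    filter_upwards [eventually_ge_atTop (R ^ n)] with r hr Q hQ
    rw [hvol Q r ((pow_pos hR n).trans_le hr)] at hQ
    refine h Q (le_of_pow_le_pow_left₀ hn.ne' Q.side_pos.le ?_)
    rw [hQ]; exact hr
  · intro ε hε
    obtain ⟨d, h⟩ := (h ε hε).2.2
    filter_upwards [eventually_ge_atTop d] with d' hd Q hQ
    refine h Q (Set.subset_empty_iff.1 (hQ ▸ Set.inter_subset_inter_right _ ?_))
    exact Set.Icc_subset_Icc (fun _ => neg_le_neg hd) (fun _ => hd)

/-! ### Mollifiers and pointwise bounds for convolutions -/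

section Mollifier

variable {n : ℕ}

/-- A smooth averaging kernel on `ℝⁿ` at scale `t`, with size and Lipschitz bounds
controlled by `M`. -/
structure IsMollifier (M t : ℝ) (k : (Fin n → ℝ) → ℝ) : Prop where
  contDiff : ContDiff ℝ ((⊤ : ℕ∞) : WithTop ℕ∞) k
  eq_zero : ∀ x, t < ‖x‖ → k x = 0
  integral_eq : ∫ x, k x = 1
  abs_le : ∀ x, |k x| ≤ M / t ^ n
  lipschitz : ∀ x y, |k x - k y| ≤ M / t ^ (n + 1) * ‖x - y‖

theorem IsMollifier.hasCompactSupport {M t : ℝ} {k : (Fin n → ℝ) → ℝ} (hk : IsMollifier M t k) :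
    HasCompactSupport k :=
  HasCompactSupport.intro (isCompact_closedBall 0 t) fun x hx =>
    hk.eq_zero x (by simpa using hx)

/-- Dilates `t⁻ⁿ ρ(x / t)` of one normalised bump. The point is that a single `M` serves all scales.
-/
theorem exists_isMollifier (n : ℕ) :
    ∃ M : ℝ, 0 ≤ M ∧ ∀ t : ℝ, 0 < t → ∃ k : (Fin n → ℝ) → ℝ, IsMollifier M t k := by
  let φ : ContDiffBump (0 : Fin n → ℝ) := ⟨1 / 2, 1, by norm_num, by norm_num⟩
  let ρ : (Fin n → ℝ) → ℝ := φ.normed volume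
  have hρ : ContDiff ℝ ((⊤ : ℕ∞) : WithTop ℕ∞) ρ := φ.contDiff_normed
  have hsupp : HasCompactSupport ρ := φ.hasCompactSupport_normed
  have hzero : ∀ x, 1 < ‖x‖ → ρ x = 0 := fun x hx => by
    refine Function.notMem_support.1 fun h => ?_
    rw [φ.support_normed_eq, mem_ball_zero_iff] at h
    exact lt_asymm h hx
  obtain ⟨A, hA⟩ := hsupp.exists_bound_of_continuous hρ.continuous
  obtain ⟨L, hL⟩ := ContDiff.lipschitzWith_of_hasCompactSupport hsupp hρ (by simp)
  have hA0 : 0 ≤ A := (norm_nonneg _).trans (hA 0)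
  refine ⟨max A L, le_max_of_le_left hA0, fun t ht => ⟨fun x => (t ^ n)⁻¹ * ρ (t⁻¹ • x), ?_⟩⟩
  have htn := pow_pos ht n
  refine ⟨?_, fun x hx => ?_, ?_, fun x => ?_, fun x y => ?_⟩
  · exact contDiff_const.mul (hρ.comp (contDiff_id.const_smul t⁻¹))
  · rw [hzero, mul_zero]
    rw [norm_smul, norm_inv, Real.norm_of_nonneg ht.le, ← div_eq_inv_mul, one_lt_div ht]
    exact hx
  · rw [integral_const_mul, Measure.integral_comp_inv_smul_of_nonneg _ _ ht.le,
      φ.integral_normed]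
    simp [htn.ne']
  · rw [abs_mul, abs_of_pos (inv_pos.2 htn), ← div_eq_inv_mul]
    exact div_le_div_of_nonneg_right ((hA _).trans (le_max_left _ _)) htn.le
  · have h := hL.dist_le_mul (t⁻¹ • x) (t⁻¹ • y)
    rw [Real.dist_eq, dist_eq_norm, ← smul_sub, norm_smul, norm_inv,
      Real.norm_of_nonneg ht.le] at h
    rw [← mul_sub, abs_mul, abs_of_pos (inv_pos.2 htn)]
    calc (t ^ n)⁻¹ * |ρ (t⁻¹ • x) - ρ (t⁻¹ • y)|
        ≤ (t ^ n)⁻¹ * (max A L * (t⁻¹ * ‖x - y‖)) := by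
          gcongr
          exact h.trans (by gcongr; exact le_max_right _ _)
      _ = max A L / t ^ (n + 1) * ‖x - y‖ := by rw [pow_succ]; field_simp

/-- The convolution of `f` with the kernel `k`. -/
noncomputable def conv (k : (Fin n → ℝ) → ℝ) (f : (Fin n → ℝ) → ℂ) (x : Fin n → ℝ) : ℂ :=
  ∫ y, k (x - y) • f y

variable {M t : ℝ} {k : (Fin n → ℝ) → ℝ} {f : (Fin n → ℝ) → ℂ}

theorem contDiff_conv (hk : IsMollifier M t k) (hf : LocallyIntegrable f volume) :
    ContDiff ℝ ((⊤ : ℕ∞) : WithTop ℕ∞) (conv k f) :=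
  hk.hasCompactSupport.contDiff_convolution_right (ContinuousLinearMap.lsmul ℝ ℝ).flip hf
    hk.contDiff

theorem locallyIntegrable_conv (hk : IsMollifier M t k) (hf : LocallyIntegrable f volume) :
    LocallyIntegrable (conv k f) volume :=
  (contDiff_conv hk hf).continuous.locallyIntegrable

theorem integrable_kernel_smul (hk : IsMollifier M t k) (hf : LocallyIntegrable f volume)
    (x : Fin n → ℝ) : Integrable fun y => k (x - y) • f y :=
  hf.integrable_smul_left_of_hasCompactSupport
    (hk.contDiff.continuous.comp (continuous_const.sub continuous_id))
    (hk.hasCompactSupport.comp_homeomorph (Homeomorph.subLeft x))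

theorem conv_sub_const (hk : IsMollifier M t k) (hf : LocallyIntegrable f volume)
    (c : ℂ) (x : Fin n → ℝ) : conv k f x - c = ∫ y, k (x - y) • (f y - c) := by
  have h1 : ∫ y, k (x - y) • c = c := by
    rw [integral_smul_const, integral_sub_left_eq_self, hk.integral_eq, one_smul]
  simp only [smul_sub]
  rw [integral_sub (integrable_kernel_smul hk hf x)
    (integrable_kernel_smul hk continuous_const.locallyIntegrable x), h1, conv]

/-- Applied with `w` a translated kernel for size bounds, and with `w` a difference of two
translates for Lipschitz bounds. -/
theorem norm_integral_smul_sub_mean_le (hf : LocallyIntegrable f volume) (Q : Cube n)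
    {w : (Fin n → ℝ) → ℝ} {A : ℝ} (hA : ∀ y, |w y| ≤ A) (hw : ∀ y ∉ Q.toSet, w y = 0) :
    ‖∫ y, w y • (f y - mean f Q)‖ ≤ A * dev f Q := by
  rw [← setIntegral_eq_integral_of_forall_compl_eq_zero (s := Q.toSet)
    fun y hy => by rw [hw y hy, zero_smul], dev, ← integral_const_mul]
  refine norm_integral_le_of_norm_le ((integrableOn_sub_const hf Q _).norm.const_mul A)
    (Eventually.of_forall fun y => ?_)
  rw [norm_smul]
  exact mul_le_mul_of_nonneg_right (hA y) (norm_nonneg _)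

theorem kernel_eq_zero (hk : IsMollifier M t k) {Q : Cube n} {x : Fin n → ℝ}
    (hx : Metric.closedBall x t ⊆ Q.toSet) {y : Fin n → ℝ} (hy : y ∉ Q.toSet) :
    k (x - y) = 0 :=
  hk.eq_zero _ (by
    by_contra! h
    exact hy (hx (by rwa [Metric.mem_closedBall, dist_comm, dist_eq_norm])))

theorem norm_conv_sub_mean_le (hk : IsMollifier M t k) (hf : LocallyIntegrable f volume)
    {Q : Cube n} {x : Fin n → ℝ} (hx : Metric.closedBall x t ⊆ Q.toSet) :
    ‖conv k f x - mean f Q‖ ≤ M / t ^ n * dev f Q := by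
  rw [conv_sub_const hk hf]
  exact norm_integral_smul_sub_mean_le hf Q (fun _ => hk.abs_le _) fun y => kernel_eq_zero hk hx

theorem norm_conv_sub_conv_le (hk : IsMollifier M t k) (hf : LocallyIntegrable f volume)
    {Q : Cube n} {x y : Fin n → ℝ} (hx : Metric.closedBall x t ⊆ Q.toSet)
    (hy : Metric.closedBall y t ⊆ Q.toSet) :
    ‖conv k f x - conv k f y‖ ≤ M / t ^ (n + 1) * dev f Q * ‖x - y‖ := by
  have hi : ∀ x, Integrable fun z => k (x - z) • (f z - mean f Q) := fun x =>
    integrable_kernel_smul hk (hf.sub continuous_const.locallyIntegrable) x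
  rw [← sub_sub_sub_cancel_right _ _ (mean f Q), conv_sub_const hk hf, conv_sub_const hk hf,
    ← integral_sub (hi x) (hi y)]
  simp only [← sub_smul]
  rw [mul_right_comm]
  refine norm_integral_smul_sub_mean_le hf Q (fun z => ?_) fun z hz => ?_
  · simpa using hk.lipschitz (x - z) (y - z)
  · rw [kernel_eq_zero hk hx hz, kernel_eq_zero hk hy hz, sub_zero]

theorem norm_fderiv_conv_le (hM : 0 ≤ M) (ht : 0 < t) (hk : IsMollifier M t k)
    (hf : LocallyIntegrable f volume) {Q : Cube n} {x : Fin n → ℝ}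
    (hx : Metric.closedBall x (2 * t) ⊆ Q.toSet) :
    ‖fderiv ℝ (conv k f) x‖ ≤ M / t ^ (n + 1) * dev f Q := by
  refine norm_fderiv_le_of_lip' ℝ (mul_nonneg (by positivity) (dev_nonneg f Q)) ?_
  -- The radius `2 * t` in the hypothesis leaves room for the `t`-balls around all `y` within `t` of
  -- `x`.
  filter_upwards [Metric.closedBall_mem_nhds x ht] with y hy
  refine norm_conv_sub_conv_le hk hf ?_ ?_
  · refine (Metric.closedBall_subset_closedBall' ?_).trans hx
    rw [Metric.mem_closedBall] at hy
    linarith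
  · exact (Metric.closedBall_subset_closedBall (by linarith)).trans hx

end Mollifier

/-! ### Estimates from the oscillation at a single scale -/

section Scale

variable {n : ℕ}

theorem Cube.exists_subcube (Q : Cube n) {t : ℝ} (ht : 0 < t) {x : Fin n → ℝ}
    (hx : x ∈ Q.toSet) : ∃ i : Fin n → Fin (⌊Q.side / t⌋₊ + 1),
      x ∈ (Cube.mk (fun j => Q.corner j + t * (i j : ℕ)) t ht).toSet := by
  rw [Cube.mem_toSet] at hx
  have h0 : ∀ j, 0 ≤ (x j - Q.corner j) / t := fun j =>
    div_nonneg (by linarith [(hx j).1]) ht.le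
  refine ⟨fun j => ⟨⌊(x j - Q.corner j) / t⌋₊, Nat.lt_succ_of_le (Nat.floor_le_floor ?_)⟩, ?_⟩
  · exact div_le_div_of_nonneg_right (by linarith [(hx j).2]) ht.le
  · refine Cube.mem_toSet.2 fun j => ?_
    have h1 := Nat.floor_le (h0 j)
    have h2 := (Nat.lt_floor_add_one ((x j - Q.corner j) / t)).le
    rw [le_div_iff₀ ht] at h1
    rw [div_le_iff₀ ht] at h2
    simp only
    constructor <;> nlinarith

/-- `Q` is covered by a grid of `N ^ n` cubes of side `t`. Overlaps and overhang are harmless since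
`h ≥ 0`, and `t ≤ side` absorbs the `+ 1` in `N` into the factor 2. -/
theorem setIntegral_cube_le {h : (Fin n → ℝ) → ℝ} (h0 : ∀ x, 0 ≤ h x)
    (hiQ : ∀ P : Cube n, IntegrableOn h P.toSet) {t a : ℝ} (ht : 0 < t)
    (ha : ∀ P : Cube n, P.side = t → ∫ x in P.toSet, h x ≤ a) (Q : Cube n) (hQ : t ≤ Q.side) :
    ∫ x in Q.toSet, h x ≤ (2 * Q.side / t) ^ n * a := by
  set N := ⌊Q.side / t⌋₊ + 1
  let P : (Fin n → Fin N) → Cube n := fun i => ⟨fun j => Q.corner j + t * (i j : ℕ), t, ht⟩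
  have ha0 : 0 ≤ a := (integral_nonneg h0).trans (ha ⟨0, t, ht⟩ rfl)
  have hind : ∀ i x, 0 ≤ (P i).toSet.indicator h x := fun i x =>
    Set.indicator_nonneg (fun x _ => h0 x) x
  have hN : (N : ℝ) ≤ 2 * Q.side / t := by
    have h1 : (1 : ℝ) ≤ Q.side / t := (one_le_div ht).2 hQ
    have h2 := Nat.floor_le (zero_le_one.trans h1)
    push_cast [N]
    rw [mul_div_assoc]
    linarith
  calc ∫ x in Q.toSet, h x = ∫ x, Q.toSet.indicator h x :=
        (integral_indicator Q.measurableSet_toSet).symm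
    _ ≤ ∫ x, ∑ i, (P i).toSet.indicator h x := by
        refine integral_mono ((hiQ Q).integrable_indicator Q.measurableSet_toSet)
          (integrable_finsetSum _ fun i _ =>
            (hiQ _).integrable_indicator (P i).measurableSet_toSet) fun x => ?_
        by_cases hx : x ∈ Q.toSet
        · obtain ⟨i, hxi⟩ := Q.exists_subcube ht hx
          calc Q.toSet.indicator h x = (P i).toSet.indicator h x := by
                rw [Set.indicator_of_mem hx, Set.indicator_of_mem hxi]
            _ ≤ _ := Finset.single_le_sum (f := fun i => (P i).toSet.indicator h x)
                (fun i _ => hind i x) (Finset.mem_univ i)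
        · simp only [Set.indicator_of_notMem hx]
          exact Finset.sum_nonneg fun i _ => hind i x
    _ = ∑ i, ∫ x in (P i).toSet, h x := by
        rw [integral_finsetSum _ fun i _ =>
          (hiQ _).integrable_indicator (P i).measurableSet_toSet]
        exact Finset.sum_congr rfl fun i _ => integral_indicator (P i).measurableSet_toSet
    _ ≤ ∑ _ : Fin n → Fin N, a := Finset.sum_le_sum fun i _ => ha (P i) rfl
    _ = (N : ℝ) ^ n * a := by simp
    _ ≤ _ := by gcongr

variable {M t α η : ℝ} {k : (Fin n → ℝ) → ℝ} {f : (Fin n → ℝ) → ℂ}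

theorem rpow_four_mul_le (ht : 0 < t) (hα : α ≤ 1) :
    (4 * t) ^ (n + α : ℝ) ≤ 4 ^ (n + 1) * (t ^ n * t ^ α) := by
  rw [Real.mul_rpow (by norm_num) ht.le, Real.rpow_add ht, Real.rpow_natCast]
  refine mul_le_mul_of_nonneg_right ?_ (by positivity)
  rw [← Real.rpow_natCast]
  exact Real.rpow_le_rpow_of_exponent_le (by norm_num) (by push_cast; linarith)

/-- The cube of side `4 * t` centred at each point bounds the gradient there; the mean value
inequality makes the bound global. -/
theorem norm_conv_sub_le_of_scale (hM : 0 ≤ M) (ht : 0 < t) (hα : α ≤ 1) (hη : 0 ≤ η)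
    (hk : IsMollifier M t k) (hf : LocallyIntegrable f volume)
    (h : ∀ Q : Cube n, Q.side = 4 * t → dev f Q ≤ η * Q.side ^ (n + α : ℝ)) (x y : Fin n → ℝ) :
    ‖conv k f x - conv k f y‖ ≤ M * 4 ^ (n + 1) * η * (t ^ α / t) * ‖x - y‖ := by
  refine convex_univ.norm_image_sub_le_of_norm_fderiv_le (𝕜 := ℝ)
    (fun z _ => (contDiff_conv hk hf).differentiable (by simp) z) (fun z _ => ?_)
    (Set.mem_univ y) (Set.mem_univ x)
  have ht2 : 0 < 2 * t := by positivity
  have h4 : (Cube.ball z (2 * t) ht2).side = 4 * t := by simp only [Cube.ball]; ring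
  refine (norm_fderiv_conv_le hM ht hk hf (Q := Cube.ball z (2 * t) ht2)
    (Cube.toSet_ball z _ _).ge).trans ?_
  have h1 := h _ h4
  rw [h4] at h1
  calc M / t ^ (n + 1) * dev f (Cube.ball z (2 * t) ht2)
      ≤ M / t ^ (n + 1) * (η * (4 ^ (n + 1) * (t ^ n * t ^ α))) := by
        gcongr
        exact h1.trans (mul_le_mul_of_nonneg_left (rpow_four_mul_le ht hα) hη)
    _ = M * 4 ^ (n + 1) * η * (t ^ α / t) := by
        rw [pow_succ t n]
        field_simp

/-- A Lipschitz constant of order `η t^(α-1)` gives variation of order `η t^(α-1) side` on `Q`, and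
`t^(α-1) side ≤ side^α` when `side ≤ t`. For `α = 1` this is an equality for every side, which is
what the endpoint case exploits. -/
theorem osc_conv_le_of_scale (hn : 0 < n) (hM : 0 ≤ M) (ht : 0 < t) (hα : α ≤ 1) (hη : 0 ≤ η)
    (hk : IsMollifier M t k) (hf : LocallyIntegrable f volume)
    (h : ∀ Q : Cube n, Q.side = 4 * t → dev f Q ≤ η * Q.side ^ (n + α : ℝ)) (Q : Cube n)
    (hQ : Q.side ≤ t ∨ α = 1) :
    osc α (conv k f) Q ≤ ENNReal.ofReal (2 * M * 4 ^ (n + 1) * η) := by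
  have hs := Q.side_pos
  have hc := locallyIntegrable_conv hk hf
  refine (osc_le_iff hn hc Q (by positivity)).2 ?_
  have hta : 0 < t ^ α := Real.rpow_pos_of_pos ht α
  have h1 : t ^ α / t * Q.side ≤ Q.side ^ α := by
    rcases hQ with hQ | rfl
    · have h2 : (Q.side / t) ^ (1 : ℝ) ≤ (Q.side / t) ^ α :=
        Real.rpow_le_rpow_of_exponent_ge (by positivity) ((div_le_one ht).2 hQ) hα
      rw [Real.rpow_one, Real.div_rpow hs.le ht.le, le_div_iff₀ hta] at h2
      calc t ^ α / t * Q.side = Q.side / t * t ^ α := by ring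
        _ ≤ _ := h2
    · simp [ht.ne']
  have h2 := dev_le_of_norm_sub_le hc Q (conv k f Q.corner)
    (a := M * 4 ^ (n + 1) * η * (t ^ α / t) * Q.side) fun x hx =>
      (norm_conv_sub_le_of_scale hM ht hα hη hk hf h x Q.corner).trans
        (mul_le_mul_of_nonneg_left (Cube.norm_sub_le hx Q.corner_mem) (by positivity))
  refine h2.trans ?_
  rw [Real.rpow_add hs, Real.rpow_natCast]
  calc 2 * (M * 4 ^ (n + 1) * η * (t ^ α / t) * Q.side * Q.side ^ n)
      = 2 * M * 4 ^ (n + 1) * η * Q.side ^ n * (t ^ α / t * Q.side) := by ring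
    _ ≤ 2 * M * 4 ^ (n + 1) * η * Q.side ^ n * Q.side ^ α := by gcongr
    _ = _ := by ring

/-- Compare both functions with the mean over the larger cube `Q`; the factor `t⁻ⁿ` in the pointwise
bound for `conv k f` cancels against `|P| = tⁿ`. -/
theorem setIntegral_sub_conv_le (ht : 0 < t) (hk : IsMollifier M t k)
    (hf : LocallyIntegrable f volume) (P : Cube n) (hP : P.side = t) {Q : Cube n}
    (hPQ : ∀ x ∈ P.toSet, Metric.closedBall x t ⊆ Q.toSet) :
    ∫ x in P.toSet, ‖f x - conv k f x‖ ≤ (1 + M) * dev f Q := by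
  have hsub : P.toSet ⊆ Q.toSet := fun x hx => hPQ x hx (Metric.mem_closedBall_self ht.le)
  have hi := (integrableOn_sub_const hf P (mean f Q)).norm
  have hc : IntegrableOn (fun _ : Fin n → ℝ => M / t ^ n * dev f Q) P.toSet :=
    integrableOn_const P.volume_toSet_ne_top
  calc ∫ x in P.toSet, ‖f x - conv k f x‖
      ≤ ∫ x in P.toSet, (‖f x - mean f Q‖ + M / t ^ n * dev f Q) := by
        refine setIntegral_mono_on (integrableOn_cube (hf.sub (locallyIntegrable_conv hk hf)) P).norm
          (hi.add hc) P.measurableSet_toSet fun x hx => ?_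
        have := norm_conv_sub_mean_le hk hf (hPQ x hx)
        have h2 := norm_sub_le_norm_sub_add_norm_sub (f x) (mean f Q) (conv k f x)
        rw [norm_sub_rev (mean f Q)] at h2
        linarith
    _ = (∫ x in P.toSet, ‖f x - mean f Q‖) + M * dev f Q := by
        rw [integral_add hi hc, setIntegral_const, P.volume_real_toSet, hP, smul_eq_mul]
        field_simp
    _ ≤ dev f Q + M * dev f Q := by
        gcongr
        exact setIntegral_mono_set (integrableOn_sub_const hf Q _).norm
          (Eventually.of_forall fun _ => norm_nonneg _) hsub.eventuallyLE
    _ = _ := by ring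

/-- About `(side / t)^n` grid cubes each contribute `O(η t^(n+α))`, for a total of order `η side^n
t^α`; `0 ≤ α` and `t ≤ side` then give `t^α ≤ side^α`. -/
theorem osc_sub_conv_le_of_scale (hn : 0 < n) (hM : 0 ≤ M) (ht : 0 < t) (h0 : 0 ≤ α) (hα : α ≤ 1)
    (hη : 0 ≤ η) (hk : IsMollifier M t k) (hf : LocallyIntegrable f volume)
    (h : ∀ Q : Cube n, Q.side = 4 * t → dev f Q ≤ η * Q.side ^ (n + α : ℝ)) (Q : Cube n)
    (hQ : t ≤ Q.side) :
    osc α (f - conv k f) Q ≤ ENNReal.ofReal (2 * 2 ^ n * (1 + M) * 4 ^ (n + 1) * η) := by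
  have hs := Q.side_pos
  have hd := hf.sub (locallyIntegrable_conv hk hf)
  refine (osc_le_iff hn hd Q (by positivity)).2 ?_
  have h1 : ∀ P : Cube n, P.side = t → ∫ x in P.toSet, ‖(f - conv k f) x‖ ≤
      (1 + M) * (η * (4 ^ (n + 1) * (t ^ n * t ^ α))) := fun P hP => by
    have ht2 : 0 < 2 * t := by positivity
    have h4 : (Cube.ball P.corner (2 * t) ht2).side = 4 * t := by simp only [Cube.ball]; ring
    refine (setIntegral_sub_conv_le ht hk hf P hP (Q := Cube.ball P.corner (2 * t) ht2)
      fun x hx => ?_).trans ?_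
    · rw [Cube.toSet_ball]
      refine Metric.closedBall_subset_closedBall' ?_
      have := Cube.norm_sub_le hx P.corner_mem
      rw [dist_eq_norm]
      linarith
    · have h5 := h _ h4
      rw [h4] at h5
      gcongr
      exact h5.trans (mul_le_mul_of_nonneg_left (rpow_four_mul_le ht hα) hη)
  have h2 := setIntegral_cube_le (fun _ => norm_nonneg _) (fun P => (integrableOn_cube hd P).norm) ht h1 Q hQ
  have h3 := dev_le hd Q 0
  simp only [sub_zero] at h3
  have h4 : t ^ α ≤ Q.side ^ α := Real.rpow_le_rpow ht.le hQ h0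
  rw [Real.rpow_add hs, Real.rpow_natCast]
  calc dev (f - conv k f) Q
      ≤ 2 * ((2 * Q.side / t) ^ n * ((1 + M) * (η * (4 ^ (n + 1) * (t ^ n * t ^ α))))) := by
        linarith
    _ = 2 * 2 ^ n * (1 + M) * 4 ^ (n + 1) * η * (Q.side ^ n * t ^ α) := by
        rw [div_pow, mul_pow]
        field_simp
    _ ≤ _ := by gcongr

end Scale

/-! ### Oscillation of negatives and differences -/

section Negation

variable {n : ℕ}

theorem mean_neg (f : (Fin n → ℝ) → ℂ) (Q : Cube n) : mean (-f) Q = -mean f Q := by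
  simp [mean, setAverage_eq]

theorem osc_neg (α : ℝ) (f : (Fin n → ℝ) → ℂ) (Q : Cube n) : osc α (-f) Q = osc α f Q := by
  simp only [osc, mean_neg, Pi.neg_apply, ← neg_sub', enorm_neg]

theorem osc_sub_le (hn : 0 < n) (α : ℝ) {f g : (Fin n → ℝ) → ℂ}
    (hf : LocallyIntegrable f volume) (hg : LocallyIntegrable g volume) (Q : Cube n) :
    osc α (f - g) Q ≤ osc α f Q + osc α g Q := by
  rw [sub_eq_add_neg, ← osc_neg α g]
  exact osc_add_le hn α hf hg.neg Q

end Negation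

/-! ### Approximation of `CMO_α` functions by test functions -/

section Approximation

variable {n : ℕ} {f : (Fin n → ℝ) → ℂ} {α : ℝ}

/-- Mollification at scale `t` controls the oscillation of `conv k f` on cubes of side at most `t`
and of `f - conv k f` on the other cubes by the oscillation of `f` on cubes of side `4 * t`. -/
theorem exists_mollifier_osc_le (hn : 0 < n) : ∃ M : ℝ, 0 ≤ M ∧ ∃ C : ℝ, 0 ≤ C ∧
    ∀ t : ℝ, 0 < t → ∃ k : (Fin n → ℝ) → ℝ, IsMollifier M t k ∧
      ∀ (f : (Fin n → ℝ) → ℂ) (α η : ℝ), LocallyIntegrable f volume → 0 ≤ α → α ≤ 1 → 0 ≤ η →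
        (∀ Q : Cube n, Q.side = 4 * t → osc α f Q ≤ ENNReal.ofReal η) → ∀ Q : Cube n,
          (Q.side ≤ t ∨ α = 1 → osc α (conv k f) Q ≤ ENNReal.ofReal (C * η)) ∧
          (t ≤ Q.side → osc α (f - conv k f) Q ≤ ENNReal.ofReal (C * η)) := by
  obtain ⟨M, hM, h⟩ := exists_isMollifier n
  refine ⟨M, hM, 2 * 2 ^ n * (1 + M) * 4 ^ (n + 1), by positivity, fun t ht => ?_⟩
  obtain ⟨k, hk⟩ := h t ht
  refine ⟨k, hk, fun f α η hf h0 h1 hη hosc Q => ?_⟩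
  have hdev : ∀ Q : Cube n, Q.side = 4 * t → dev f Q ≤ η * Q.side ^ (n + α : ℝ) :=
    fun Q hQ => (osc_le_iff hn hf Q hη).1 (hosc Q hQ)
  refine ⟨fun hQ => (osc_conv_le_of_scale hn hM ht h1 hη hk hf hdev Q hQ).trans
    (ENNReal.ofReal_le_ofReal ?_), osc_sub_conv_le_of_scale hn hM ht h0 h1 hη hk hf hdev Q⟩
  have h2 : (1 : ℝ) ≤ 2 ^ n := one_le_pow₀ one_le_two
  gcongr
  · exact le_mul_of_one_le_right zero_le_two h2
  · linarith

theorem ofReal_add_mul_le {C η ε : ℝ} (hC : 0 ≤ C) (hη : 0 ≤ η) (h : (1 + C) * η ≤ ε) :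
    ENNReal.ofReal η + ENNReal.ofReal (C * η) ≤ ENNReal.ofReal ε := by
  rw [← ENNReal.ofReal_add hη (mul_nonneg hC hη)]
  exact ENNReal.ofReal_le_ofReal (by linarith)

/-- A function in `CMO_α` is close to its mollification at small scales, and its mollification at
large scales is small. -/
theorem exists_conv_approx (hn : 0 < n) (h0 : 0 ≤ α) (h1 : α ≤ 1) (hf : f ∈ CMO n α) {ε : ℝ}
    (hε : 0 < ε) : ∃ M : ℝ, 0 ≤ M ∧
      (∃ t : ℝ, 0 < t ∧ ∃ k : (Fin n → ℝ) → ℝ, IsMollifier M t k ∧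
        bmoNorm α (f - conv k f) ≤ ENNReal.ofReal ε) ∧
      ∃ t : ℝ, 0 < t ∧ ∃ k : (Fin n → ℝ) → ℝ, IsMollifier M t k ∧
        bmoNorm α (conv k f) ≤ ENNReal.ofReal ε := by
  obtain ⟨⟨hloc, -⟩, hf⟩ := (mem_CMO_iff hn).1 hf
  obtain ⟨M, hM, C, hC, h⟩ := exists_mollifier_osc_le hn
  have hη : 0 < ε / (1 + C) := by positivity
  have hηε : (1 + C) * (ε / (1 + C)) ≤ ε := (mul_div_cancel₀ ε (by positivity)).le
  set η := ε / (1 + C)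
  obtain ⟨⟨δ, hδ, hs⟩, ⟨R, hR, hl⟩, -⟩ := hf (ENNReal.ofReal η) (ENNReal.ofReal_pos.2 hη)
  have hsum := ofReal_add_mul_le hC hη.le hηε
  refine ⟨M, hM, ⟨δ / 8, by positivity, ?_⟩, R, hR, ?_⟩
  -- With `t = δ / 8`, cubes of side `4 * t = δ / 2` are below the threshold `δ`.
  · obtain ⟨k, hk, h⟩ := h (δ / 8) (by positivity)
    refine ⟨k, hk, iSup_le fun Q => ?_⟩
    have hQ := h f α η hloc h0 h1 hη.le (fun Q hQ => hs Q (by linarith)) Q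
    rcases le_total Q.side (δ / 8) with hq | hq
    · refine (osc_sub_le hn α hloc (locallyIntegrable_conv hk hloc) Q).trans ?_
      exact (add_le_add (hs Q (by linarith)) (hQ.1 (Or.inl hq))).trans hsum
    · exact (hQ.2 hq).trans (le_add_self.trans hsum)
  · obtain ⟨k, hk, h⟩ := h R hR
    refine ⟨k, hk, iSup_le fun Q => ?_⟩
    have hQ := h f α η hloc h0 h1 hη.le (fun Q hQ => hl Q (by linarith)) Q
    rcases le_total Q.side R with hq | hq
    · exact (hQ.1 (Or.inl hq)).trans (le_add_self.trans hsum)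
    -- On large cubes `conv k f` is written as `f - (f - conv k f)`, both terms being small there.
    · have h2 := osc_sub_le hn α hloc (hloc.sub (locallyIntegrable_conv hk hloc)) Q
      rw [sub_sub_cancel] at h2
      exact h2.trans ((add_le_add (hl Q hq) (hQ.2 hq)).trans hsum)

theorem Cube.ball_inter_Icc_eq_empty (hn : 0 < n) {x : Fin n → ℝ} {r d : ℝ} (hr : 0 < r)
    (hx : d + r < ‖x‖) :
    (Cube.ball x r hr).toSet ∩ Set.Icc (fun _ => -d) (fun _ => d) = ∅ := by
  rw [Cube.toSet_ball]
  refine Set.eq_empty_of_forall_notMem fun y ⟨h1, h2, h3⟩ => ?_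
  have hd : 0 ≤ d := by linarith [h2 ⟨0, hn⟩, h3 ⟨0, hn⟩]
  have hy : ‖y‖ ≤ d := (pi_norm_le_iff_of_nonneg hd).2 fun i => abs_le.2 ⟨h2 i, h3 i⟩
  rw [Metric.mem_closedBall, dist_comm, dist_eq_norm] at h1
  linarith [norm_le_norm_add_norm_sub' x y]

/-- Differences of mollifications vanish at infinity together with their derivatives. -/
theorem conv_sub_conv_vanish (hn : 0 < n) (hf : f ∈ CMO n α) {M t t' : ℝ} (hM : 0 ≤ M)
    (ht : 0 < t) (ht' : 0 < t') {k k' : (Fin n → ℝ) → ℝ} (hk : IsMollifier M t k)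
    (hk' : IsMollifier M t' k') {ε : ℝ} (hε : 0 < ε) : ∃ R : ℝ, ∀ x : Fin n → ℝ, R ≤ ‖x‖ →
      ‖(conv k f - conv k' f) x‖ ≤ ε ∧ ‖fderiv ℝ (conv k f - conv k' f) x‖ ≤ ε := by
  obtain ⟨⟨hloc, -⟩, hf⟩ := (mem_CMO_iff hn).1 hf
  -- This radius makes one cube around `x` serve both kernels, for values and for gradients, so that
  -- the two convolutions are compared with the same mean.
  have hs : 0 < 2 * (t + t') := by positivity
  set s := 2 * (t + t') with hs_def
  set A := M / t ^ n + M / t' ^ n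
  set B := M / t ^ (n + 1) + M / t' ^ (n + 1)
  set V := (2 * s) ^ (n + α : ℝ)
  have hA : 0 ≤ A := by positivity
  have hB : 0 ≤ B := by positivity
  have hV : 0 < V := by positivity
  have hη : 0 < ε / ((A + B + 1) * V) := by positivity
  obtain ⟨-, -, d, hd⟩ := hf _ (ENNReal.ofReal_pos.2 hη)
  refine ⟨d + s + 1, fun x hx => ?_⟩
  have hosc := (osc_le_iff hn hloc _ hη.le).1
    (hd (Cube.ball x s hs) (Cube.ball_inter_Icc_eq_empty hn hs (by linarith)))
  set Q := Cube.ball x s hs with hQ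
  have hdev : (A + B + 1) * dev f Q ≤ ε := by
    have : ε / ((A + B + 1) * V) * Q.side ^ (n + α : ℝ) = ε / (A + B + 1) := by
      change ε / ((A + B + 1) * V) * V = _
      field_simp
    rw [this, le_div_iff₀ (by positivity)] at hosc
    linarith
  have hd0 := dev_nonneg f Q
  have hsub : ∀ r ≤ s, Metric.closedBall x r ⊆ Q.toSet := fun r hr => by
    rw [hQ, Cube.toSet_ball]
    exact Metric.closedBall_subset_closedBall hr
  constructor
  · have h1 := norm_conv_sub_mean_le hk hloc (hsub t (by linarith))
    have h2 := norm_conv_sub_mean_le hk' hloc (hsub t' (by linarith))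
    rw [norm_sub_rev] at h2
    calc ‖conv k f x - conv k' f x‖ ≤ A * dev f Q := by
          have := norm_sub_le_norm_sub_add_norm_sub (conv k f x) (mean f Q) (conv k' f x)
          rw [add_mul]
          linarith
      _ ≤ (A + B + 1) * dev f Q := by gcongr; linarith
      _ ≤ ε := hdev
  · have h1 := norm_fderiv_conv_le hM ht hk hloc (hsub (2 * t) (by linarith))
    have h2 := norm_fderiv_conv_le hM ht' hk' hloc (hsub (2 * t') (by linarith))
    rw [fderiv_sub ((contDiff_conv hk hloc).differentiable (by simp) x)
      ((contDiff_conv hk' hloc).differentiable (by simp) x)]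
    calc ‖fderiv ℝ (conv k f) x - fderiv ℝ (conv k' f) x‖ ≤ B * dev f Q := by
          have := norm_sub_le (fderiv ℝ (conv k f) x) (fderiv ℝ (conv k' f) x)
          rw [add_mul]
          linarith
      _ ≤ (A + B + 1) * dev f Q := by gcongr; linarith
      _ ≤ ε := hdev

/-- Smooth functions vanishing at infinity to first order are limits of test functions. -/
theorem exists_testFunction_approx (hn : 0 < n) (h0 : 0 ≤ α) (h1 : α ≤ 1)
    {h : (Fin n → ℝ) → ℂ} (hh : ContDiff ℝ ((⊤ : ℕ∞) : WithTop ℕ∞) h)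
    (hv : ∀ ε : ℝ, 0 < ε → ∃ R : ℝ, ∀ x, R ≤ ‖x‖ → ‖h x‖ ≤ ε ∧ ‖fderiv ℝ h x‖ ≤ ε)
    {ε : ℝ} (hε : 0 < ε) : ∃ g ∈ testFunctions n, bmoNorm α (h - g) ≤ ENNReal.ofReal ε := by
  let χ : ContDiffBump (0 : Fin n → ℝ) := ⟨1, 2, by norm_num, by norm_num⟩
  have hχ : ContDiff ℝ ((⊤ : ℕ∞) : WithTop ℕ∞) χ := χ.contDiff
  obtain ⟨L, hL⟩ := ContDiff.lipschitzWith_of_hasCompactSupport χ.hasCompactSupport hχ (by simp)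
  -- The product rule for cutoff times `h` costs `1 + L`; `bmoNorm_le_of_lipschitz` costs the 2.
  have ha : 0 < ε / (2 * (1 + L)) := by positivity
  have haε : 2 * ((1 + L) * (ε / (2 * (1 + L)))) = ε := by field_simp
  set a := ε / (2 * (1 + L))
  obtain ⟨R₀, hR₀⟩ := hv a ha
  -- `1 ≤ R` ensures that the dilated cutoff still has Lipschitz constant `L`.
  set R := max R₀ 1
  have hR1 : 1 ≤ R := le_max_right _ _
  have hR : 0 < R := one_pos.trans_le hR1
  let u : (Fin n → ℝ) → ℝ := fun x => 1 - χ (R⁻¹ • x)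
  have hχR : ContDiff ℝ ((⊤ : ℕ∞) : WithTop ℕ∞) fun x => χ (R⁻¹ • x) :=
    hχ.comp (contDiff_id.const_smul R⁻¹)
  have hu : ContDiff ℝ ((⊤ : ℕ∞) : WithTop ℕ∞) u := contDiff_const.sub hχR
  have hu0 : ∀ x, ‖x‖ < R → u x = 0 := fun x hx => by
    have : χ (R⁻¹ • x) = 1 := χ.one_of_mem_closedBall (by
      rw [mem_closedBall_zero_iff, norm_smul, norm_inv, Real.norm_of_nonneg hR.le,
        ← div_eq_inv_mul, div_le_one hR]
      exact hx.le)
    simp [u, this]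
  have hu1 : ∀ x, ‖u x‖ ≤ 1 := fun x => by
    rw [Real.norm_eq_abs, abs_le]
    constructor <;> linarith [χ.nonneg (x := R⁻¹ • x), χ.le_one (x := R⁻¹ • x)]
  have huL : LipschitzWith L u := LipschitzWith.of_dist_le_mul fun x y => by
    have h2 := hL.dist_le_mul (R⁻¹ • x) (R⁻¹ • y)
    rw [Real.dist_eq] at h2 ⊢
    rw [sub_sub_sub_cancel_left, abs_sub_comm]
    refine h2.trans (mul_le_mul_of_nonneg_left ?_ L.2)
    rw [dist_smul₀, norm_inv, Real.norm_of_nonneg hR.le]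
    exact mul_le_of_le_one_left dist_nonneg (inv_le_one_of_one_le₀ hR1)
  have hk : h - (fun x => χ (R⁻¹ • x) • h x) = fun x => u x • h x := by
    ext x
    simp only [u, Pi.sub_apply, sub_smul, one_smul]
  refine ⟨fun x => χ (R⁻¹ • x) • h x, ⟨hχR.smul hh, ?_⟩, ?_⟩
  · refine HasCompactSupport.intro (isCompact_closedBall 0 (2 * R)) fun x hx => ?_
    have : χ (R⁻¹ • x) = 0 := χ.zero_of_le_dist (by
      rw [dist_zero_right, norm_smul, norm_inv, Real.norm_of_nonneg hR.le, ← div_eq_inv_mul,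
        le_div_iff₀ hR]
      simpa using (not_le.1 (mt mem_closedBall_zero_iff.2 hx)).le)
    rw [this, zero_smul]
  · rw [hk, ← haε]
    have hd : ∀ x, ‖fderiv ℝ (fun x => u x • h x) x‖ ≤ (1 + L) * a := fun x => by
      rcases lt_or_ge ‖x‖ R with hx | hx
      · have h2 : (fun x => u x • h x) =ᶠ[𝓝 x] fun _ => 0 := by
          filter_upwards [(isOpen_lt continuous_norm continuous_const).mem_nhds hx] with y hy
          rw [hu0 y hy, zero_smul]
        rw [h2.fderiv_eq, fderiv_fun_const]
        simp only [Pi.zero_apply, norm_zero]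
        positivity
      · obtain ⟨h2, h3⟩ := hR₀ x ((le_max_left _ _).trans hx)
        rw [fderiv_fun_smul (hu.differentiable (by simp) x) (hh.differentiable (by simp) x)]
        refine (norm_add_le _ _).trans ?_
        rw [norm_smul, ContinuousLinearMap.norm_smulRight_apply, add_mul]
        exact add_le_add (mul_le_mul (hu1 x) h3 (norm_nonneg _) zero_le_one)
          (mul_le_mul (norm_fderiv_le_of_lipschitz ℝ huL) h2 (norm_nonneg _) L.2)
    refine bmoNorm_le_of_lipschitz hn h0 h1 (hu.smul hh).continuous (by positivity)
      (fun x => ?_) fun x y => ?_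
    · rcases lt_or_ge ‖x‖ R with hx | hx
      · rw [Pi.smul_apply', hu0 x hx, zero_smul, norm_zero]
        positivity
      · rw [Pi.smul_apply', norm_smul]
        calc ‖u x‖ * ‖h x‖ ≤ 1 * a :=
              mul_le_mul (hu1 x) (hR₀ x ((le_max_left _ _).trans hx)).1 (norm_nonneg _) zero_le_one
          _ ≤ (1 + L) * a := by gcongr; exact le_add_of_nonneg_right L.2
    · exact convex_univ.norm_image_sub_le_of_norm_fderiv_le (𝕜 := ℝ)
        (fun z _ => (hu.smul hh).differentiable (by simp) z) (fun z _ => hd z)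
        (Set.mem_univ y) (Set.mem_univ x)

theorem exists_pos_ofReal_lt {ε : ℝ≥0∞} (hε : 0 < ε) : ∃ r : ℝ, 0 < r ∧ ENNReal.ofReal r < ε := by
  obtain ⟨r, -, h1, h2⟩ := ENNReal.lt_iff_exists_real_btwn.1 hε
  exact ⟨r, ENNReal.ofReal_pos.1 h1, h2⟩

theorem CMO_subset_closureTest (hn : 0 < n) (h0 : 0 ≤ α) (h1 : α ≤ 1) :
    CMO n α ⊆ closureTest n α := by
  intro f hf
  refine ⟨hf.1, fun ε hε => ?_⟩
  obtain ⟨r, hr, hrε⟩ := exists_pos_ofReal_lt hε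
  have hr3 : 0 < r / 3 := by positivity
  obtain ⟨M, hM, ⟨t, ht, k, hk, hs⟩, t', ht', k', hk', hl⟩ :=
    exists_conv_approx hn h0 h1 hf hr3
  have hloc := hf.1.1
  have hc := locallyIntegrable_conv hk hloc
  have hc' := locallyIntegrable_conv hk' hloc
  obtain ⟨g, hg, hgh⟩ := exists_testFunction_approx hn h0 h1
    ((contDiff_conv hk hloc).sub (contDiff_conv hk' hloc))
    (fun ε hε => conv_sub_conv_vanish hn hf hM ht ht' hk hk' hε) hr3
  refine ⟨g, hg, lt_of_le_of_lt ?_ hrε⟩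
  have hgl : LocallyIntegrable g volume := hg.1.continuous.locallyIntegrable
  -- Small-scale error, large-scale mollification, and cutoff error: `r / 3` each.
  have heq : f - g = (f - conv k f) + (conv k' f + ((conv k f - conv k' f) - g)) := by abel
  rw [heq]
  have h2 := bmoNorm_add_le hn α hc' ((hc.sub hc').sub hgl)
  have h3 := bmoNorm_add_le hn α (hloc.sub hc) (hc'.add ((hc.sub hc').sub hgl))
  refine h3.trans ((add_le_add hs (h2.trans (add_le_add hl hgh))).trans ?_)
  rw [← ENNReal.ofReal_add hr3.le hr3.le, ← ENNReal.ofReal_add hr3.le (by positivity)]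
  exact ENNReal.ofReal_le_ofReal (by linarith)

end Approximation

/-! ### Test functions and the vanishing conditions -/

section TestFunctions

variable {n : ℕ} {g : (Fin n → ℝ) → ℂ} {α : ℝ}

theorem exists_lipschitz_of_mem_testFunctions (hg : g ∈ testFunctions n) :
    ∃ A : ℝ, 0 ≤ A ∧ (∀ x, ‖g x‖ ≤ A) ∧ ∀ x y, ‖g x - g y‖ ≤ A * ‖x - y‖ := by
  obtain ⟨A, hA⟩ := hg.2.exists_bound_of_continuous hg.1.continuous
  obtain ⟨L, hL⟩ := ContDiff.lipschitzWith_of_hasCompactSupport hg.2 hg.1 (by simp)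
  refine ⟨max A L, le_max_of_le_right L.2, fun x => (hA x).trans (le_max_left _ _), fun x y => ?_⟩
  have h := hL.dist_le_mul x y
  rw [dist_eq_norm, dist_eq_norm] at h
  exact h.trans (mul_le_mul_of_nonneg_right (le_max_right _ _) (norm_nonneg _))

theorem testFunctions_subset_closureTest (hn : 0 < n) (h0 : 0 ≤ α) (h1 : α ≤ 1) :
    testFunctions n ⊆ closureTest n α := by
  intro g hg
  obtain ⟨A, hA, hb, hL⟩ := exists_lipschitz_of_mem_testFunctions hg
  refine ⟨⟨hg.1.continuous.locallyIntegrable,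
    (bmoNorm_le_of_lipschitz hn h0 h1 hg.1.continuous hA hb hL).trans_lt ENNReal.ofReal_lt_top⟩,
    fun ε hε => ⟨g, hg, ?_⟩⟩
  have h2 : bmoNorm α (g - g) ≤ ENNReal.ofReal (2 * 0) :=
    bmoNorm_le_of_lipschitz hn h0 h1 (by rw [sub_self]; exact continuous_zero) le_rfl
      (by simp) (by simp)
  exact h2.trans_lt (by simpa using hε)

/-- The Lipschitz bound gives oscillation at most `2 A side^(1-α)`, which tends to zero precisely
because `α < 1`. -/
theorem osc_small_cube_le (hn : 0 < n) (h1 : α < 1) (hg : g ∈ testFunctions n) {ε : ℝ}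
    (hε : 0 < ε) : ∃ δ : ℝ, 0 < δ ∧ ∀ Q : Cube n, Q.side < δ → osc α g Q ≤ ENNReal.ofReal ε := by
  obtain ⟨A, hA, -, hL⟩ := exists_lipschitz_of_mem_testFunctions hg
  have hlim : Tendsto (fun x : ℝ => 2 * A * x ^ (1 - α)) (𝓝 0) (𝓝 0) := by
    have h := (Real.continuousAt_rpow_const 0 (1 - α) (Or.inr (by linarith))).tendsto.const_mul
      (2 * A)
    rwa [Real.zero_rpow (by linarith), mul_zero] at h
  obtain ⟨δ, hδ, h⟩ := Metric.eventually_nhds_iff.1 (hlim.eventually_le_const hε)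
  refine ⟨δ, hδ, fun Q hQ => ?_⟩
  have hs := Q.side_pos
  have hloc : LocallyIntegrable g volume := hg.1.continuous.locallyIntegrable
  refine (osc_le_iff hn hloc Q hε.le).2 ?_
  have h2 : 2 * A * Q.side ^ (1 - α) ≤ ε := h (by simpa [abs_of_pos hs] using hQ)
  refine (dev_le_of_norm_sub_le hloc Q (g Q.corner) (a := A * Q.side) fun x hx =>
    (hL _ _).trans (mul_le_mul_of_nonneg_left (Cube.norm_sub_le hx Q.corner_mem) hA)).trans ?_
  calc 2 * (A * Q.side * Q.side ^ n)
      = 2 * A * Q.side ^ (1 - α) * Q.side ^ (n + α : ℝ) := by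
        rw [mul_assoc (2 * A), ← Real.rpow_add hs,
          show 1 - α + (n + α) = ((n + 1 : ℕ) : ℝ) by push_cast; ring, Real.rpow_natCast, pow_succ]
        ring
    _ ≤ _ := by gcongr

/-- The unnormalised oscillation never exceeds `2 ∫ ‖g‖`, whereas `side^(n+α) ≥ side` once `side ≥
1`, even for `α = 0`. -/
theorem osc_large_cube_le (hn : 0 < n) (h0 : 0 ≤ α) (hg : g ∈ testFunctions n) {ε : ℝ}
    (hε : 0 < ε) : ∃ R : ℝ, 0 < R ∧ ∀ Q : Cube n, R ≤ Q.side → osc α g Q ≤ ENNReal.ofReal ε := by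
  refine ⟨max 1 (2 * (∫ x, ‖g x‖) / ε), lt_max_of_lt_left one_pos, fun Q hQ => ?_⟩
  have hloc : LocallyIntegrable g volume := hg.1.continuous.locallyIntegrable
  have h1 : (1 : ℝ) ≤ n := by exact_mod_cast hn
  refine (osc_le_iff hn hloc Q hε.le).2 ((dev_le hloc Q 0).trans ?_)
  simp only [sub_zero]
  have h2 := (le_max_right _ _).trans hQ
  rw [div_le_iff₀ hε] at h2
  have h3 : Q.side ≤ Q.side ^ (n + α : ℝ) :=
    Real.self_le_rpow_of_one_le ((le_max_left _ _).trans hQ) (by linarith)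
  calc 2 * ∫ x in Q.toSet, ‖g x‖ ≤ 2 * ∫ x, ‖g x‖ :=
        mul_le_mul_of_nonneg_left (setIntegral_le_integral
          (hg.1.continuous.integrable_of_hasCompactSupport hg.2).norm
          (Eventually.of_forall fun _ => norm_nonneg _)) zero_le_two
    _ ≤ Q.side * ε := h2
    _ ≤ ε * Q.side ^ (n + α : ℝ) := by rw [mul_comm]; gcongr

theorem osc_far_cube_eq_zero (hn : 0 < n) (hg : g ∈ testFunctions n) : ∃ d : ℝ, ∀ Q : Cube n,
    Q.toSet ∩ Set.Icc (fun _ => -d) (fun _ => d) = ∅ → osc α g Q = 0 := by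
  obtain ⟨d, hd⟩ := hg.2.isBounded.subset_closedBall (0 : Fin n → ℝ)
  refine ⟨d, fun Q hQ => ?_⟩
  have hloc : LocallyIntegrable g volume := hg.1.continuous.locallyIntegrable
  have h : osc α g Q ≤ ENNReal.ofReal 0 := by
    refine (osc_le_iff hn hloc Q le_rfl).2
      ((dev_le_of_norm_sub_le hloc Q 0 (a := 0) fun x hx => ?_).trans (by simp))
    have hx' : g x = 0 := by
      by_contra hne
      have h1 := mem_closedBall_zero_iff.1 (hd (subset_tsupport g hne))
      have h2 : ∀ i, |x i| ≤ d := fun i => (norm_le_pi_norm x i).trans h1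
      exact Set.notMem_empty x (hQ ▸ ⟨hx, fun i => (abs_le.1 (h2 i)).1,
        fun i => (abs_le.1 (h2 i)).2⟩)
    simp [hx']
  simpa using h

/-- The seminorm bounds the error `f - g` uniformly over all cubes, so each condition passes from
`g` to `f`. -/
theorem closureTest_subset_CMO (hn : 0 < n) (h0 : 0 ≤ α) (h1 : α < 1) :
    closureTest n α ⊆ CMO n α := by
  rintro f ⟨hf, happ⟩
  refine (mem_CMO_iff hn).2 ⟨hf, fun ε hε => ?_⟩
  obtain ⟨r, hr, hrε⟩ := exists_pos_ofReal_lt hε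
  have hr2 : 0 < r / 2 := by positivity
  obtain ⟨g, hg, hfg⟩ := happ (ENNReal.ofReal (r / 2)) (ENNReal.ofReal_pos.2 hr2)
  have hgl : LocallyIntegrable g volume := hg.1.continuous.locallyIntegrable
  have key : ∀ Q : Cube n, osc α g Q ≤ ENNReal.ofReal (r / 2) → osc α f Q ≤ ε := fun Q hQ => by
    have h2 := osc_add_le hn α (hf.1.sub hgl) hgl Q
    rw [sub_add_cancel] at h2
    refine h2.trans ((add_le_add ((le_iSup (osc α (f - g)) Q).trans hfg.le) hQ).trans ?_)
    rw [← ENNReal.ofReal_add hr2.le hr2.le, add_halves]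
    exact hrε.le
  obtain ⟨δ, hδ, hs⟩ := osc_small_cube_le hn h1 hg hr2
  obtain ⟨R, hR, hl⟩ := osc_large_cube_le hn h0 hg hr2
  obtain ⟨d, hd⟩ := osc_far_cube_eq_zero (α := α) hn hg
  exact ⟨⟨δ, hδ, fun Q hQ => key Q (hs Q hQ)⟩, ⟨R, hR, fun Q hQ => key Q (hl Q hQ)⟩,
    d, fun Q hQ => key Q ((hd Q hQ).trans_le zero_le)⟩

end TestFunctions

/-! ### The endpoint `α = 1` -/

section Endpoint

variable {n : ℕ} {f : (Fin n → ℝ) → ℂ}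

/-- Only the small-cube condition is used: for a fixed `Q` and small `t`, both `conv k f` and `f -
conv k f` have oscillation `O(η)` on `Q`, with `η` arbitrary. -/
theorem dev_eq_zero_of_mem_CMO_one (hn : 0 < n) (hf : f ∈ CMO n 1) (Q : Cube n) :
    dev f Q = 0 := by
  obtain ⟨⟨hloc, -⟩, hf⟩ := (mem_CMO_iff hn).1 hf
  obtain ⟨M, hM, C, hC, h⟩ := exists_mollifier_osc_le hn
  have hs := Q.side_pos
  have hosc : osc 1 f Q ≤ ENNReal.ofReal 0 := by
    rw [ENNReal.ofReal_zero]
    refine le_of_forall_gt fun ε hε => ?_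
    obtain ⟨r, hr, hrε⟩ := exists_pos_ofReal_lt hε
    have hη : 0 < r / (2 * C + 1) := by positivity
    have hηr : C * (r / (2 * C + 1)) + C * (r / (2 * C + 1)) ≤ r := by
      rw [← two_mul, ← mul_assoc, mul_div_assoc', div_le_iff₀ (by positivity)]
      nlinarith
    set η := r / (2 * C + 1)
    obtain ⟨δ, hδ, hsm⟩ := (hf (ENNReal.ofReal η) (ENNReal.ofReal_pos.2 hη)).1
    -- Below `δ / 8` the small-cube condition applies at scale `4 * t`; `t ≤ Q.side` is needed for
    -- the bound on `f - conv k f`.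
    have ht : 0 < min (δ / 8) Q.side := lt_min (by positivity) hs
    obtain ⟨k, hk, h⟩ := h _ ht
    obtain ⟨h1, h2⟩ := h f 1 η hloc zero_le_one le_rfl hη.le
      (fun Q' hQ' => hsm Q' (by linarith [min_le_left (δ / 8) Q.side])) Q
    have hc := locallyIntegrable_conv hk hloc
    have h3 := osc_add_le hn 1 (hloc.sub hc) hc Q
    rw [sub_add_cancel] at h3
    refine (h3.trans ((add_le_add (h2 (min_le_right _ _)) (h1 (Or.inr rfl))).trans ?_)).trans_lt hrε
    rw [← ENNReal.ofReal_add (by positivity) (by positivity)]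
    exact ENNReal.ofReal_le_ofReal hηr
  refine le_antisymm ?_ (dev_nonneg f Q)
  simpa using (osc_le_iff hn hloc Q le_rfl).1 hosc

theorem ae_eq_mean_of_dev_eq_zero (hf : LocallyIntegrable f volume) {Q : Cube n}
    (h : dev f Q = 0) : ∀ᵐ x, x ∈ Q.toSet → f x = mean f Q := by
  rw [dev, integral_eq_zero_iff_of_nonneg (fun _ => norm_nonneg _)
    (integrableOn_sub_const hf Q _).norm] at h
  filter_upwards [(ae_restrict_iff' Q.measurableSet_toSet).1 h] with x hx hxQ
  simpa [sub_eq_zero] using hx hxQ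

/-- `f` is almost everywhere constant on each cube of an exhaustion; the constants agree because all
these cubes contain the first, which has positive measure. -/
theorem ae_const_of_dev_eq_zero (hf : LocallyIntegrable f volume) (h : ∀ Q : Cube n, dev f Q = 0) :
    ∃ c : ℂ, f =ᵐ[volume] fun _ => c := by
  let B : ℕ → Cube n := fun m => Cube.ball 0 (m + 1) (by positivity)
  have hsub : ∀ m, (B 0).toSet ⊆ (B m).toSet := fun m => by
    simp only [B, Cube.toSet_ball]
    exact Metric.closedBall_subset_closedBall (by simp)
  have hB : ∀ m, ∀ᵐ x, x ∈ (B m).toSet → f x = mean f (B m) := fun m =>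
    ae_eq_mean_of_dev_eq_zero hf (h _)
  have hm : ∀ m, mean f (B m) = mean f (B 0) := fun m => by
    by_contra hne
    refine (B 0).volume_toSet_ne_zero (measure_mono_null (fun x hx => ?_)
      (ae_iff.1 ((hB 0).and (hB m))))
    intro hx'
    exact hne ((hx'.2 (hsub m hx)).symm.trans (hx'.1 hx))
  refine ⟨mean f (B 0), ?_⟩
  filter_upwards [ae_all_iff.2 hB] with x hx
  obtain ⟨m, hxm⟩ := exists_nat_ge ‖x‖
  rw [hx m, hm m]
  simp only [B, Cube.toSet_ball, mem_closedBall_zero_iff]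
  linarith

theorem locallyIntegrable_of_ae_const {c : ℂ} (h : f =ᵐ[volume] fun _ => c) :
    LocallyIntegrable f volume := fun x =>
  (continuous_const.locallyIntegrable (f := fun _ => c) x).congr h.symm

theorem osc_eq_zero_of_ae_const (hn : 0 < n) (α : ℝ) {c : ℂ} (h : f =ᵐ[volume] fun _ => c)
    (Q : Cube n) : osc α f Q = 0 := by
  have hloc := locallyIntegrable_of_ae_const h
  have h1 : osc α f Q ≤ ENNReal.ofReal 0 := by
    refine (osc_le_iff hn hloc Q le_rfl).2 ((dev_le hloc Q c).trans ?_)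
    rw [integral_eq_zero_of_ae]
    · simp
    · filter_upwards [ae_restrict_of_ae h] with x hx
      simp [hx]
  simpa using h1

theorem CMO_one_eq (hn : 0 < n) :
    CMO n 1 = {f : (Fin n → ℝ) → ℂ | ∃ c : ℂ, f =ᵐ[volume] fun _ => c} := by
  refine Set.Subset.antisymm (fun f hf => ae_const_of_dev_eq_zero hf.1.1
    (dev_eq_zero_of_mem_CMO_one hn hf)) ?_
  rintro f ⟨c, hc⟩
  have h := osc_eq_zero_of_ae_const hn 1 hc
  refine (mem_CMO_iff hn).2 ⟨⟨locallyIntegrable_of_ae_const hc, ?_⟩, fun ε _ => ?_⟩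
  · simp [bmoNorm, h]
  · simp only [h, zero_le, implies_true, and_true, exists_const]
    exact ⟨⟨1, one_pos⟩, 1, one_pos⟩

theorem exists_testFunction_not_ae_const (hn : 0 < n) : ∃ g ∈ testFunctions n,
    ¬ ∃ c : ℂ, g =ᵐ[volume] fun _ => c := by
  let χ : ContDiffBump (0 : Fin n → ℝ) := ⟨1, 2, by norm_num, by norm_num⟩
  have hχ : ContDiff ℝ ((⊤ : ℕ∞) : WithTop ℕ∞) χ := χ.contDiff
  have hg : ContDiff ℝ ((⊤ : ℕ∞) : WithTop ℕ∞) fun x => (χ x : ℂ) :=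
    Complex.ofRealCLM.contDiff.comp hχ
  refine ⟨fun x => (χ x : ℂ), ⟨hg, χ.hasCompactSupport.comp_left Complex.ofReal_zero⟩, ?_⟩
  rintro ⟨c, hc⟩
  -- Continuity upgrades almost everywhere equality to equality, so the values at `0` and `(3, …,
  -- 3)` can be compared.
  have heq := (Continuous.ae_eq_iff_eq volume hg.continuous continuous_const).1 hc
  have h0 : χ 0 = 1 := χ.one_of_mem_closedBall (by simp [χ])
  have h3 : χ (fun _ => 3) = 0 := χ.zero_of_le_dist (by
    rw [dist_zero_right]
    refine le_trans ?_ (norm_le_pi_norm (fun _ => (3 : ℝ)) (⟨0, hn⟩ : Fin n))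
    simp only [Real.norm_eq_abs]
    norm_num [χ])
  have h1 := (congrFun heq 0).trans (congrFun heq fun _ => 3).symm
  simp [h0, h3] at h1

theorem CMO_one_ssubset_closureTest (hn : 0 < n) : CMO n 1 ⊂ closureTest n 1 := by
  refine (Set.ssubset_iff_of_subset (CMO_subset_closureTest hn zero_le_one le_rfl)).2 ?_
  obtain ⟨g, hg, hc⟩ := exists_testFunction_not_ae_const hn
  refine ⟨g, testFunctions_subset_closureTest hn zero_le_one le_rfl hg, ?_⟩
  rw [CMO_one_eq hn]
  exact hc

end Endpoint

end FracOsc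

theorem mainTheorem2 (n : ℕ) (hn : 0 < n) :
    (∀ α : ℝ, 0 ≤ α → α < 1 → FracOsc.closureTest n α = FracOsc.CMO n α) ∧
      FracOsc.CMO n 1 ⊂ FracOsc.closureTest n 1 ∧
      FracOsc.CMO n 1 = {f | ∃ c : ℂ, f =ᵐ[volume] fun _ => c} :=
  ⟨fun _ h0 h1 => Set.Subset.antisymm (FracOsc.closureTest_subset_CMO hn h0 h1)
    (FracOsc.CMO_subset_closureTest hn h0 h1.le),
    FracOsc.CMO_one_ssubset_closureTest hn, FracOsc.CMO_one_eq hn⟩
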